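/- Let $\mathcal K$ be a separable complex Hilbert space. A positive $\mathcal B(\mathcal K)$-valued measure $\Omega$ on the Borel sets of $\mathbb R$ assigns to each Borel set a nonnegative bounded operator and is countably additive in the strong operator topology (in particular $0\le\Omega(\mathbb R)\in\mathcal B(\mathcal K)$). A function $M:\mathbb C\setminus\mathbb R\to\mathcal B(\mathcal K)$ is Herglotz if it is analytic on $\mathbb C_+$ with $\operatorname{Im}M(z)=(M(z)-M(z)^*)/(2i)\ge 0$ and $M(\bar z)=M(z)^*$ for $z\in\mathbb C_+$. Let $\mathcal N_1(\mathcal K)$ be the class of Herglotz functions of the form $$M(z)=\int_{\mathbb R}d\Omega(\lambda)\,(\lambda-z)^{-1},\qquad z\in\mathbb C\setminus\mathbb R,$$ for some such $\Omega$, the integral converging in the norm of $\mathcal B(\mathcal K)$; $\Omega$ is then called a measure associated with $M$. **(i)** Let $M\in\mathcal N_1(\mathcal K)$ have associated measure $\Omega$. Then there are a separable complex Hilbert space $\mathcal H$, a (possibly unbounded) self-adjoint operator $H$ in $\mathcal H$ and $K\in\mathcal B(\mathcal K,\mathcal H)$ such that $$M(z)=K^*(H-z)^{-1}K\quad (z\in\mathbb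 C\setminus\mathbb R),\qquad \Omega(\mathbb R)=K^*K.$$ **(ii)** Let $M_1\neq M_2$ be in $\mathcal N_1(\mathcal K)$ with associated measures $\Omega_1,\Omega_2$, and let $L_1,L_2\in\mathcal B(\mathcal K)$ be self-adjoint. Call a triple $(\mathcal H,H_0,K)$, with $\mathcal H$ a separable complex Hilbert space, $H_0$ self-adjoint in $\mathcal H$ and $K\in\mathcal B(\mathcal K,\mathcal H)$, a common realization (with parameters $L_1,L_2$) if the operators $H_{L_\ell}=H_0+KL_\ell K^*$, $\operatorname{dom}(H_{L_\ell})=\operatorname{dom}(H_0)$, are self-adjoint and $$M_\ell(z)=K^*(H_{L_\ell}-z)^{-1}K,\qquad z\in\mathbb C\setminus\mathbb R,\ \ell=1,2.$$ A common realization exists if and only if the following two conditions hold: (a) $\Omega_1(\mathbb R)=K^*K=\Omega_2(\mathbb R)$ for some bounded operator $K$ from $\mathcal K$ into a separable complex Hilbert space; (b) for all $z\in\mathbb C\setminus\mathbb R$, $I_{\mathcal K}+(L_2-L_1)M_1(z)$ has an inverse in $\mathcal B(\mathcal K)$ and $M_2(z)=M_1(z)\bigl(I_{\mathcal K}+(L_2-L_1)M_1(z)\bigr)^{-1}$.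 Moreover, for every common realization $(\mathcal H,H_0,K)$, (b) holds and (a) holds with this very operator $K$. -/

import Mathlib

open scoped Topology

universe u

noncomputable section

section Measures

variable {𝒦 : Type u} [NormedAddCommGroup 𝒦] [InnerProductSpace ℂ 𝒦]

/-- A positive bounded-operator-valued measure on the Borel sets of `ℝ`: its values are nonnegative
bounded operators and it is countably additive in the strong operator topology.
(Values on sets which are not Borel are irrelevant.) -/
structure PositiveOperatorMeasure (𝒦 : Type u) [NormedAddCommGroup 𝒦] [InnerProductSpace ℂ 𝒦] where
  /-- The operator assigned to a set. -/
  toFun : Set ℝ → (𝒦 →L[ℂ] 𝒦)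
  empty' : toFun ∅ = 0
  isPositive' : ∀ B, MeasurableSet B → (toFun B).IsPositive
  hasSum_iUnion' : ∀ B : ℕ → Set ℝ, (∀ i, MeasurableSet (B i)) →
    Pairwise (Function.onFun Disjoint B) →
    ∀ ξ : 𝒦, HasSum (fun i => toFun (B i) ξ) (toFun (⋃ i, B i) ξ)

instance : CoeFun (PositiveOperatorMeasure 𝒦) (fun _ => Set ℝ → (𝒦 →L[ℂ] 𝒦)) :=
  ⟨PositiveOperatorMeasure.toFun⟩

/-- The integral `∫ dΩ(t) s(t)` of a (complex) simple function. -/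
def PositiveOperatorMeasure.simpleIntegral (Ω : PositiveOperatorMeasure 𝒦)
    (s : MeasureTheory.SimpleFunc ℝ ℂ) : 𝒦 →L[ℂ] 𝒦 :=
  ∑ c ∈ s.range, c • Ω (s ⁻¹' {c})

/-- `T = ∫ dΩ(t) f(t)`, the integral being convergent in operator norm: `T` is the norm limit
of the integrals of simple functions converging to `f` uniformly on `ℝ`. -/
def PositiveOperatorMeasure.HasIntegral (Ω : PositiveOperatorMeasure 𝒦) (f : ℝ → ℂ)
    (T : 𝒦 →L[ℂ] 𝒦) : Prop :=
  ∃ s : ℕ → MeasureTheory.SimpleFunc ℝ ℂ,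
    TendstoUniformly (fun n t => s n t) f Filter.atTop ∧
    Filter.Tendsto (fun n => Ω.simpleIntegral (s n)) Filter.atTop (𝓝 T)

/-- `M(z) = ∫ dΩ(t) (t - z)⁻¹` for all `z ∈ ℂ \ ℝ`, i.e. `Ω` is the measure associated
with `M`. -/
def IsStieltjesRepresentation (M : ℂ → (𝒦 →L[ℂ] 𝒦)) (Ω : PositiveOperatorMeasure 𝒦) : Prop :=
  ∀ z : ℂ, z.im ≠ 0 → Ω.HasIntegral (fun t : ℝ => ((t : ℂ) - z)⁻¹) (M z)

/-- Operator-valued Herglotz functions: analytic on the open upper half-plane, with nonnegative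
imaginary part there, extended to the lower half-plane by `M(conj z) = M(z)^*`.
The values on the real line are irrelevant. -/
structure IsHerglotz [CompleteSpace 𝒦] (M : ℂ → (𝒦 →L[ℂ] 𝒦)) : Prop where
  analytic : DifferentiableOn ℂ M {z : ℂ | 0 < z.im}
  im_nonneg : ∀ z : ℂ, 0 < z.im →
    ((2 * Complex.I)⁻¹ • (M z - ContinuousLinearMap.adjoint (M z))).IsPositive
  map_conj : ∀ z : ℂ, 0 < z.im →
    M ((starRingEnd ℂ) z) = ContinuousLinearMap.adjoint (M z)

/-- The class `𝒩₁(𝒦)` of operator-valued Herglotz functions of the form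
`M(z) = ∫ dΩ(t) (t - z)⁻¹`, with `Ω` a positive measure with `Ω(ℝ)` bounded. -/
def NevanlinnaOne (𝒦 : Type u) [NormedAddCommGroup 𝒦] [InnerProductSpace ℂ 𝒦]
    [CompleteSpace 𝒦] : Set (ℂ → (𝒦 →L[ℂ] 𝒦)) :=
  {M | IsHerglotz M ∧ ∃ Ω : PositiveOperatorMeasure 𝒦, IsStieltjesRepresentation M Ω}

/-- `M₂(z) = M₁(z) (I + (L₂ - L₁) M₁(z))⁻¹` for all `z ∈ ℂ \ ℝ`, where the inverse is
an inverse in the algebra of bounded operators (and in particular exists). -/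
def LinearFractionalRelation (M₁ M₂ : ℂ → (𝒦 →L[ℂ] 𝒦)) (L₁ L₂ : 𝒦 →L[ℂ] 𝒦) : Prop :=
  ∀ z : ℂ, z.im ≠ 0 →
    IsUnit (1 + (L₂ - L₁) * M₁ z) ∧ M₂ z = M₁ z * Ring.inverse (1 + (L₂ - L₁) * M₁ z)

end Measures

section Realizations

variable {𝒦 ℋ : Type u} [NormedAddCommGroup 𝒦] [InnerProductSpace ℂ 𝒦] [CompleteSpace 𝒦]
  [NormedAddCommGroup ℋ] [InnerProductSpace ℂ ℋ] [CompleteSpace ℋ]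

/-- `R = (A - z)⁻¹`, a bounded everywhere defined two-sided inverse of the (possibly unbounded)
operator `A - z`. -/
def IsResolventAt (A : ℋ →ₗ.[ℂ] ℋ) (z : ℂ) (R : ℋ →L[ℂ] ℋ) : Prop :=
  (∀ y : ℋ, ∃ h : R y ∈ A.domain, A ⟨R y, h⟩ - z • R y = y) ∧
  ∀ x : A.domain, R (A x - z • (x : ℋ)) = x

/-- `M(z) = K^* (A - z)⁻¹ K` for all `z ∈ ℂ \ ℝ`. -/
def IsRealizedBy (M : ℂ → (𝒦 →L[ℂ] 𝒦)) (A : ℋ →ₗ.[ℂ] ℋ) (K : 𝒦 →L[ℂ] ℋ) : Prop :=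
  ∀ z : ℂ, z.im ≠ 0 → ∃ R : ℋ →L[ℂ] ℋ, IsResolventAt A z R ∧
    M z = (ContinuousLinearMap.adjoint K).comp (R.comp K)

/-- The perturbed operator `H_L = H₀ + K L K^*`, with `dom (H_L) = dom (H₀)`. -/
def perturbedOperator (H₀ : ℋ →ₗ.[ℂ] ℋ) (K : 𝒦 →L[ℂ] ℋ) (L : 𝒦 →L[ℂ] 𝒦) : ℋ →ₗ.[ℂ] ℋ :=
  (K.comp (L.comp (ContinuousLinearMap.adjoint K))).toLinearMap +ᵥ H₀

/-- `M₁` and `M₂` are realized, through `K`, by self-adjoint perturbations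
`H₀ + K L₁ K^*` and `H₀ + K L₂ K^*` of the same self-adjoint operator `H₀`. -/
structure IsCommonRealization (M₁ M₂ : ℂ → (𝒦 →L[ℂ] 𝒦)) (L₁ L₂ : 𝒦 →L[ℂ] 𝒦)
    (H₀ : ℋ →ₗ.[ℂ] ℋ) (K : 𝒦 →L[ℂ] ℋ) : Prop where
  selfAdjoint : IsSelfAdjoint H₀
  selfAdjoint₁ : IsSelfAdjoint (perturbedOperator H₀ K L₁)
  selfAdjoint₂ : IsSelfAdjoint (perturbedOperator H₀ K L₂)
  realizes₁ : IsRealizedBy M₁ (perturbedOperator H₀ K L₁) K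
  realizes₂ : IsRealizedBy M₂ (perturbedOperator H₀ K L₂) K

end Realizations

end

/-! Part (i) is Naimark's dilation. The `𝒦`-valued simple functions carry the semi-inner product `∫
⟪f, dΩ g⟫`; completing (which also removes null vectors) gives an `L²(Ω; 𝒦)`. On it a scalar simple
function `s` acts by multiplication, with norm at most `sup |s|`, and with `K` the embedding of
constants, `K^* s K = ∫ s dΩ` (`adjoint_embed_mul_embed`). Simple functions tending uniformly to `(t
- z)⁻¹` give norm limits `R z`, which inherit `R z^* = R (conj z)` and the resolvent identity; `R i`
is injective since `(t - i)⁻¹` is bounded below on bounded sets. Such a family is the resolvent of a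
self-adjoint `H` (`exists_isSelfAdjoint_of_resolvent_identity`). Passing to the limit gives `M(z) =
K^* R z K`, and `s = 1` gives `K^* K = Ω(ℝ)`.

For part (ii), `K^* K` is the strong limit of `-i y M(i y)` in any self-adjoint realization, hence
depends only on `M` and equals `Ω(ℝ)`. The second resolvent identity, compressed by `K`, yields the
linear fractional relation. Conversely, take the dilation `H` of `Ω₁` and put `H₀ = H - K L₁ K^*`:
then `H₀ + K L₁ K^* = H` realizes `M₁`, and the inverse in the relation supplies the resolvent of `H
+ K (L₂ - L₁) K^*`, whose compression is `M₂`. -/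

noncomputable section

/-! ### Resolvents and perturbations of unbounded self-adjoint operators -/

section UnboundedOperators

open ContinuousLinearMap Filter
open scoped InnerProductSpace

/-- The second resolvent identity for a bounded perturbation. -/
theorem IsResolventAt.sub_eq_of_perturbation {ℋ : Type u} [NormedAddCommGroup ℋ]
    [InnerProductSpace ℂ ℋ] {A : ℋ →ₗ.[ℂ] ℋ} {B B' : ℋ →L[ℂ] ℋ} {z : ℂ}
    {R R' : ℋ →L[ℂ] ℋ} (hR : IsResolventAt ((B : ℋ →ₗ[ℂ] ℋ) +ᵥ A) z R)
    (hR' : IsResolventAt ((B' : ℋ →ₗ[ℂ] ℋ) +ᵥ A) z R') : R' - R = R * (B - B') * R' := by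
  ext v
  obtain ⟨h, hv⟩ := hR'.1 v
  have h1 := hR.2 ⟨R' v, h⟩
  simp only [LinearPMap.vadd_apply, coe_coe] at hv h1
  change R' v - R v = R (B (R' v) - B' (R' v))
  conv_lhs => rw [← h1]
  rw [← map_sub]
  congr 1
  generalize R' v = w at *
  rw [← hv]
  abel

variable {ℋ : Type u} [NormedAddCommGroup ℋ] [InnerProductSpace ℂ ℋ] [CompleteSpace ℋ]

/-- A self-adjoint operator is symmetric. -/
lemma LinearPMap.inner_map_comm_of_isSelfAdjoint {A : ℋ →ₗ.[ℂ] ℋ} (hA : IsSelfAdjoint A)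
    (x y : A.domain) : ⟪A x, (y : ℋ)⟫_ℂ = ⟪(x : ℋ), A y⟫_ℂ := by
  have h := LinearPMap.adjoint_isFormalAdjoint (T := A) hA.dense_domain
  rw [LinearPMap.isSelfAdjoint_def.mp hA] at h
  exact h x y

/-- A densely defined symmetric operator possessing resolvents at `± i` is self-adjoint. -/
theorem LinearPMap.isSelfAdjoint_of_isResolventAt {A : ℋ →ₗ.[ℂ] ℋ}
    (hd : Dense (A.domain : Set ℋ))
    (hs : ∀ x y : A.domain, ⟪A x, (y : ℋ)⟫_ℂ = ⟪(x : ℋ), A y⟫_ℂ) {R R' : ℋ →L[ℂ] ℋ}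
    (hR : IsResolventAt A Complex.I R) (hR' : IsResolventAt A (-Complex.I) R') :
    IsSelfAdjoint A := by
  rw [LinearPMap.isSelfAdjoint_def]
  have hle : A ≤ A.adjoint := LinearPMap.IsFormalAdjoint.le_adjoint hd hs
  refine (LinearPMap.eq_of_le_of_domain_eq hle (le_antisymm hle.1 fun y hy => ?_)).symm
  have hfa := LinearPMap.adjoint_isFormalAdjoint (T := A) hd
  set w := A.adjoint ⟨y, hy⟩ - Complex.I • y with hw
  obtain ⟨hx, hxe⟩ := hR.1 w
  -- The vector `y - R w` is annihilated by `A^* - i`, hence orthogonal to the range of `A + i`,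
  -- which is all of `ℋ`.
  have key : y = R w := by
    rw [← sub_eq_zero, ← inner_self_eq_zero (𝕜 := ℂ)]
    obtain ⟨hv, hve⟩ := hR'.1 (y - R w)
    have h1 := hfa ⟨y, hy⟩ ⟨_, hv⟩
    have h2 := hs ⟨_, hx⟩ ⟨_, hv⟩
    have h3 : A.adjoint ⟨y, hy⟩ = A ⟨R w, hx⟩ - Complex.I • R w + Complex.I • y := by
      rw [hxe, hw]; abel
    rw [h3] at h1
    simp only [inner_add_left, inner_sub_left, inner_smul_left, Complex.conj_I] at h1 h2
    have h4 : ⟪y - R w, y - R w⟫_ℂ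
        = ⟪y - R w, A ⟨R' (y - R w), hv⟩ - (-Complex.I) • R' (y - R w)⟫_ℂ := by rw [hve]
    rw [h4]
    generalize R' (y - R w) = r at *
    simp only [inner_sub_left, inner_sub_right, inner_smul_right]
    rw [← h2, ← h1]
    ring
  rw [key]; exact hx

/-- A bounded self-adjoint perturbation of a self-adjoint operator is self-adjoint. -/
theorem IsSelfAdjoint.vadd_linearPMap {A : ℋ →ₗ.[ℂ] ℋ} (hA : IsSelfAdjoint A) {B : ℋ →L[ℂ] ℋ}
    (hB : IsSelfAdjoint B) : IsSelfAdjoint ((B : ℋ →ₗ[ℂ] ℋ) +ᵥ A) := by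
  rw [LinearPMap.isSelfAdjoint_def]
  have hd := hA.dense_domain
  have hBs : ∀ x y, ⟪B x, y⟫_ℂ = ⟪x, B y⟫_ℂ := fun x y => by
    rw [← ContinuousLinearMap.adjoint_inner_right, isSelfAdjoint_iff'.mp hB]
  have hs : ∀ x y : A.domain, ⟪((B : ℋ →ₗ[ℂ] ℋ) +ᵥ A) x, (y : ℋ)⟫_ℂ
      = ⟪(x : ℋ), ((B : ℋ →ₗ[ℂ] ℋ) +ᵥ A) y⟫_ℂ := fun x y => by
    simp only [LinearPMap.vadd_apply, inner_add_left, inner_add_right]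
    rw [LinearPMap.inner_map_comm_of_isSelfAdjoint hA]
    congr 1
    exact hBs _ _
  have hle : ((B : ℋ →ₗ[ℂ] ℋ) +ᵥ A) ≤ ((B : ℋ →ₗ[ℂ] ℋ) +ᵥ A).adjoint :=
    LinearPMap.IsFormalAdjoint.le_adjoint hd hs
  refine (LinearPMap.eq_of_le_of_domain_eq hle (le_antisymm hle.1 fun y hy => ?_)).symm
  have hfa := LinearPMap.adjoint_isFormalAdjoint (T := ((B : ℋ →ₗ[ℂ] ℋ) +ᵥ A)) hd
  -- The functional `x ↦ ⟪y, A x⟫` is represented by `(A + B)^* y - B y`, so `y` lies in `dom A^* =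
  -- dom A`.
  have hA' : y ∈ A.adjoint.domain := by
    refine LinearPMap.mem_adjoint_domain_of_exists y
      ⟨((B : ℋ →ₗ[ℂ] ℋ) +ᵥ A).adjoint ⟨y, hy⟩ - B y, fun x => ?_⟩
    have h1 := hfa ⟨y, hy⟩ x
    rw [inner_sub_left, hBs]
    refine sub_eq_of_eq_add (h1.trans ?_)
    rw [LinearPMap.vadd_apply, inner_add_right, add_comm]
    rfl
  rwa [LinearPMap.isSelfAdjoint_def.mp hA] at hA'

/-- The self-adjoint operator with a given resolvent family. -/
theorem exists_isSelfAdjoint_of_resolvent_identity {R : ℂ → ℋ →L[ℂ] ℋ}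
    (hadj : ∀ z : ℂ, z.im ≠ 0 → adjoint (R z) = R (starRingEnd ℂ z))
    (hres : ∀ z w : ℂ, z.im ≠ 0 → w.im ≠ 0 → R z - R w = (z - w) • (R z * R w))
    (hinj : ∀ x, R Complex.I x = 0 → x = 0) :
    ∃ A : ℋ →ₗ.[ℂ] ℋ, IsSelfAdjoint A ∧ ∀ z : ℂ, z.im ≠ 0 → IsResolventAt A z (R z) := by
  have hI : Complex.I.im ≠ 0 := by simp
  have hI' : (-Complex.I).im ≠ 0 := by simp
  have hres' : ∀ z w : ℂ, z.im ≠ 0 → w.im ≠ 0 → ∀ x,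
      R z x = R w x + (z - w) • R z (R w x) := fun z w hz hw x => by
    have := congrArg (fun T => T x) (hres z w hz hw)
    simp only [sub_apply, smul_apply] at this
    exact sub_eq_iff_eq_add'.mp this
  have hker : Function.Injective (R Complex.I : ℋ →ₗ[ℂ] ℋ) :=
    (injective_iff_map_eq_zero _).mpr hinj
  let e := LinearEquiv.ofInjective (R Complex.I : ℋ →ₗ[ℂ] ℋ) hker
  -- The only candidate is `R(i)⁻¹ + i` on the range of `R(i)`.
  let A : ℋ →ₗ.[ℂ] ℋ :=
    { domain := LinearMap.range (R Complex.I : ℋ →ₗ[ℂ] ℋ)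
      toFun := e.symm.toLinearMap + Complex.I • Submodule.subtype _ }
  have hmem : ∀ u, R Complex.I u ∈ A.domain := fun u => ⟨u, rfl⟩
  have hA : ∀ u, A ⟨R Complex.I u, hmem u⟩ = u + Complex.I • R Complex.I u := fun u => by
    change e.symm _ + Complex.I • R Complex.I u = _
    congr 1
    rw [LinearEquiv.symm_apply_eq]
    rfl
  have hsurj : ∀ x : A.domain, ∃ u, x = ⟨R Complex.I u, hmem u⟩ := fun x => by
    obtain ⟨x, u, rfl⟩ := x
    exact ⟨u, rfl⟩
  have hRA : ∀ z : ℂ, z.im ≠ 0 → IsResolventAt A z (R z) := fun z hz => by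
    refine ⟨fun y => ?_, fun x => ?_⟩
    -- The resolvent identity puts the range of every `R z` inside that of `R(i)`.
    · have h1 : R z y = R Complex.I (y + (z - Complex.I) • R z y) := by
        have := hres' Complex.I z hI hz y
        rw [map_add, map_smul, this, add_assoc, ← add_smul]
        simp
      refine ⟨h1 ▸ hmem _, ?_⟩
      have h2 : (⟨R z y, h1 ▸ hmem _⟩ : A.domain)
          = ⟨R Complex.I (y + (z - Complex.I) • R z y), hmem _⟩ := Subtype.ext h1
      rw [h2, hA, ← h1]
      module
    · obtain ⟨u, rfl⟩ := hsurj x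
      rw [hA]
      have := hres' z Complex.I hz hI u
      simp only [map_add, map_sub, map_smul]
      rw [this]
      generalize R z (R Complex.I u) = t
      module
  refine ⟨A, LinearPMap.isSelfAdjoint_of_isResolventAt ?_ ?_ (hRA _ hI) (hRA _ hI'), hRA⟩
  -- A vector orthogonal to the range of `R(i)` is killed by `R(i)^* = R(-i)`, hence by `R(i)`
  -- through the resolvent identity.
  · rw [Submodule.dense_iff_topologicalClosure_eq_top, Submodule.topologicalClosure_eq_top_iff,
      Submodule.eq_bot_iff]
    intro v hv
    have h0 : R (-Complex.I) v = 0 := by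
      rw [← Complex.conj_I, ← hadj _ hI]
      refine ext_inner_left ℂ fun u => ?_
      rw [ContinuousLinearMap.adjoint_inner_right, inner_zero_right]
      exact hv _ (hmem u)
    apply hinj
    rw [hres' Complex.I (-Complex.I) hI hI', h0, map_zero, smul_zero, add_zero]
  · intro x y
    obtain ⟨u, rfl⟩ := hsurj x
    obtain ⟨v, rfl⟩ := hsurj y
    rw [hA, hA]
    have h1 : ∀ a b, ⟪R Complex.I a, b⟫_ℂ = ⟪a, R (-Complex.I) b⟫_ℂ := fun a b => by
      rw [← ContinuousLinearMap.adjoint_inner_right, hadj _ hI, Complex.conj_I]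
    have h2 := hres' (-Complex.I) Complex.I hI' hI v
    simp only [inner_add_left, inner_smul_left, h1, map_add, map_smul]
    rw [h2]
    simp only [inner_add_right, inner_smul_right, Complex.conj_I]
    ring

/-- Resolvents of a self-adjoint operator on the imaginary axis are bounded by `1 / |y|`. -/
theorem norm_resolvent_le {A : ℋ →ₗ.[ℂ] ℋ} (hA : IsSelfAdjoint A) {y : ℝ} {R : ℋ →L[ℂ] ℋ}
    (hR : IsResolventAt A (y * Complex.I) R) (v : ℋ) : |y| * ‖R v‖ ≤ ‖v‖ := by
  obtain ⟨h, hv⟩ := hR.1 v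
  set u := R v
  have hsym := LinearPMap.inner_map_comm_of_isSelfAdjoint hA ⟨u, h⟩ ⟨u, h⟩
  have him : (⟪u, A ⟨u, h⟩⟫_ℂ).im = 0 := by
    rw [← Complex.conj_eq_iff_im, inner_conj_symm]
    exact hsym
  -- Since `⟪u, A u⟫` is real, only the shift by `i y` contributes to the imaginary part.
  have h1 : (⟪u, v⟫_ℂ).im = - (y * ‖u‖ ^ 2) := by
    rw [← hv, inner_sub_right, inner_smul_right, Complex.sub_im, him,
      inner_self_eq_norm_sq_to_K]
    simp [Complex.mul_im, pow_two]
  have h2 : |y| * ‖u‖ ^ 2 ≤ ‖u‖ * ‖v‖ := by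
    calc |y| * ‖u‖ ^ 2 = |(⟪u, v⟫_ℂ).im| := by rw [h1, abs_neg, abs_mul, abs_pow, abs_norm]
      _ ≤ ‖⟪u, v⟫_ℂ‖ := Complex.abs_im_le_norm _
      _ ≤ _ := norm_inner_le_norm _ _
  rcases eq_or_lt_of_le (norm_nonneg u) with h0 | h0
  · rw [← h0]; simp
  · nlinarith

/-- `-i y (A - i y)⁻¹ → 1` strongly as `y → ∞`. -/
theorem tendsto_resolvent_imaginary {A : ℋ →ₗ.[ℂ] ℋ} (hA : IsSelfAdjoint A)
    {R : ℕ → ℋ →L[ℂ] ℋ}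
    (hR : ∀ n : ℕ, IsResolventAt A (((n + 1 : ℕ) : ℝ) * Complex.I) (R n)) (v : ℋ) :
    Tendsto (fun n : ℕ => (-((((n + 1 : ℕ) : ℝ) : ℂ) * Complex.I)) • R n v) atTop (𝓝 v) := by
  have hb : ∀ n v, ‖(-((((n + 1 : ℕ) : ℝ) : ℂ) * Complex.I)) • R n v‖ ≤ ‖v‖ := fun n v => by
    have := norm_resolvent_le hA (hR n) v
    rw [norm_smul, norm_neg, norm_mul, Complex.norm_I, mul_one, Complex.norm_real]
    exact this
  -- On the domain the error is `-R (A x)`, of size `O(1/y)`; the uniform bound `hb` then extends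
  -- convergence to the closure.
  have hdom : ∀ x : A.domain, Tendsto (fun n : ℕ =>
      (-((((n + 1 : ℕ) : ℝ) : ℂ) * Complex.I)) • R n (x : ℋ)) atTop (𝓝 (x : ℋ)) := fun x => by
    rw [tendsto_iff_norm_sub_tendsto_zero]
    have hlim : Tendsto (fun n : ℕ => ‖A x‖ * (1 / ((n : ℝ) + 1))) atTop (𝓝 0) := by
      simpa using tendsto_one_div_add_atTop_nhds_zero_nat.const_mul ‖A x‖
    refine squeeze_zero (fun _ => norm_nonneg _) (fun n => ?_) hlim
    have h1 := (hR n).2 x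
    have h2 := norm_resolvent_le hA (hR n) (A x)
    have h3 : (-((((n + 1 : ℕ) : ℝ) : ℂ) * Complex.I)) • R n (x : ℋ) - x = - R n (A x) := by
      rw [map_sub, map_smul] at h1
      rw [← sub_eq_zero] at h1 ⊢
      rw [← h1]
      module
    rw [h3, norm_neg, mul_one_div, le_div_iff₀ (by positivity), mul_comm]
    rw [abs_of_nonneg (by positivity)] at h2
    simpa using h2
  rw [Metric.tendsto_atTop]
  intro ε hε
  obtain ⟨x, hx, hxv⟩ := Metric.mem_closure_iff.mp (hA.dense_domain v) (ε / 3) (by positivity)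
  obtain ⟨N, hN⟩ := Metric.tendsto_atTop.mp (hdom ⟨x, hx⟩) (ε / 3) (by positivity)
  refine ⟨N, fun n hn => ?_⟩
  have h1 := hN n hn
  have h2 := hb n (v - x)
  rw [map_sub, smul_sub] at h2
  rw [← dist_eq_norm, ← dist_eq_norm] at h2
  refine (dist_triangle4 _ ((-((((n + 1 : ℕ) : ℝ) : ℂ) * Complex.I)) • R n x) x _).trans_lt ?_
  rw [dist_comm x v]
  linarith

/-- Resolvent of a factored perturbation, constructed from the inverse of `1 + L K^* R K`. -/
theorem IsResolventAt.perturbation {𝒦 : Type u} [NormedAddCommGroup 𝒦] [InnerProductSpace ℂ 𝒦]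
    [CompleteSpace 𝒦] {A : ℋ →ₗ.[ℂ] ℋ} {z : ℂ} {R : ℋ →L[ℂ] ℋ} (hR : IsResolventAt A z R)
    (K : 𝒦 →L[ℂ] ℋ) (L N : 𝒦 →L[ℂ] 𝒦)
    (hl : (1 + L * (adjoint K ∘L R ∘L K)) * N = 1)
    (hr : N * (1 + L * (adjoint K ∘L R ∘L K)) = 1) :
    IsResolventAt (perturbedOperator A K L) z (R - R ∘L K ∘L N ∘L L ∘L adjoint K ∘L R) := by
  refine ⟨fun y => ?_, fun x => ?_⟩
  -- Here `n` solves `n + L K^* R K n = L K^* R y`, so that `L K^* R (y - K n) = n` and the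
  -- perturbation restores exactly the missing `K n`.
  · set n := N (L (adjoint K (R y))) with hn
    have e : (R - R ∘L K ∘L N ∘L L ∘L adjoint K ∘L R) y = R (y - K n) := by
      rw [map_sub]; rfl
    obtain ⟨h, hv⟩ := hR.1 (y - K n)
    rw [e]
    refine ⟨h, ?_⟩
    have h1 : n + L (adjoint K (R (K n))) = L (adjoint K (R y)) :=
      congrArg (fun T : 𝒦 →L[ℂ] 𝒦 => T (L (adjoint K (R y)))) hl
    have h2 : perturbedOperator A K L ⟨R (y - K n), h⟩
        = K (L (adjoint K (R (y - K n)))) + A ⟨R (y - K n), h⟩ := rfl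
    have h3 : L (adjoint K (R (y - K n))) = n := by
      simp only [map_sub]
      rw [← h1]; abel
    rw [h2, h3, add_sub_assoc, hv]
    abel
  · have h1 := hR.2 x
    set k := L (adjoint K x) with hk
    have h2 : perturbedOperator A K L x = K k + A x := rfl
    have h3 : R (perturbedOperator A K L x - z • (x : ℋ)) = x + R (K k) := by
      rw [h2, add_sub_assoc, map_add, h1, add_comm]
    have h4 : N (k + L (adjoint K (R (K k)))) = k :=
      congrArg (fun T : 𝒦 →L[ℂ] 𝒦 => T k) hr
    change R (perturbedOperator A K L x - z • (x : ℋ)) - R (K (N (L (adjoint K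
      (R (perturbedOperator A K L x - z • (x : ℋ))))))) = x
    rw [h3, map_add, map_add, ← hk, h4]
    abel

end UnboundedOperators

/-! ### Uniform limits under continuous functions -/

section UniformConvergence

open Filter

/-- Continuous functions of two bounded uniformly convergent sequences converge uniformly. -/
lemma TendstoUniformly.continuous_comp_of_bounded {α : Type*} {s t : ℕ → α → ℂ} {f g : α → ℂ}
    (hs : TendstoUniformly s f atTop) (ht : TendstoUniformly t g atTop) {C : ℝ}
    (hf : ∀ x, ‖f x‖ ≤ C) (hg : ∀ x, ‖g x‖ ≤ C) {Φ : ℂ × ℂ → ℂ} (hΦ : Continuous Φ)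
    {k : α → ℂ} (hk : ∀ x, Φ (f x, g x) = k x) :
    TendstoUniformly (fun n x => Φ (s n x, t n x)) k atTop := by
  rw [← funext hk]
  -- On this compact ball `Φ` is uniformly continuous; the extra `1` makes room for approximants
  -- within distance `1` of the limits.
  let S : Set (ℂ × ℂ) := Metric.closedBall 0 (C + 1)
  have hmem : ∀ p : ℂ × ℂ, ‖p.1‖ ≤ C + 1 → ‖p.2‖ ≤ C + 1 → p ∈ S := fun p h1 h2 => by
    rw [mem_closedBall_zero_iff]
    exact max_le h1 h2
  have hst : TendstoUniformly (fun n x => (s n x, t n x)) (fun x => (f x, g x)) atTop := by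
    rw [Metric.tendstoUniformly_iff] at *
    intro ε hε
    filter_upwards [hs ε hε, ht ε hε] with n h1 h2 x
    exact max_lt (h1 x) (h2 x)
  refine UniformContinuousOn.comp_tendstoUniformly_eventually (s := S) (g := Φ) ?_ ?_
    ((isCompact_closedBall _ _).uniformContinuousOn_of_continuous hΦ.continuousOn) hst
  · filter_upwards [Metric.tendstoUniformly_iff.mp hs 1 one_pos,
      Metric.tendstoUniformly_iff.mp ht 1 one_pos] with n h1 h2 x
    have h : ∀ {a b : ℂ}, dist a b < 1 → ‖a‖ ≤ C → ‖b‖ ≤ C + 1 := fun {a b} hab ha => by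
      have := norm_le_norm_add_norm_sub' b a
      rw [← dist_eq_norm, dist_comm] at this
      linarith
    exact hmem _ (h (h1 x) (hf x)) (h (h2 x) (hg x))
  · exact fun x => hmem _ (by linarith [hf x]) (by linarith [hg x])

end UniformConvergence

/-! ### Naimark dilation: additivity and sums over simple functions -/

section Dilation

open ContinuousLinearMap Filter MeasureTheory
open scoped InnerProductSpace

variable {𝒦 : Type u} [NormedAddCommGroup 𝒦] [InnerProductSpace ℂ 𝒦]

namespace PositiveOperatorMeasure

variable (Ω : PositiveOperatorMeasure 𝒦)

lemma apply_union {A B : Set ℝ} (hA : MeasurableSet A) (hB : MeasurableSet B)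
    (h : Disjoint A B) : Ω (A ∪ B) = Ω A + Ω B := by
  ext ξ
  let C : ℕ → Set ℝ := fun n => if n = 0 then A else if n = 1 then B else ∅
  have hC : ∀ n, MeasurableSet (C n) := fun n => by
    simp only [C]; split_ifs <;> simp [hA, hB]
  have hU : ⋃ n, C n = A ∪ B := by
    ext t
    simp only [Set.mem_iUnion, Set.mem_union, C]
    constructor
    · rintro ⟨n, hn⟩
      split_ifs at hn
      · exact Or.inl hn
      · exact Or.inr hn
      · exact hn.elim
    · rintro (ht | ht)
      · exact ⟨0, by simpa using ht⟩
      · exact ⟨1, by simpa using ht⟩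
  have hd : Pairwise (Function.onFun Disjoint C) := by
    intro i j hij
    simp only [Function.onFun, C]
    split_ifs <;> simp_all [disjoint_comm]
  have h1 := Ω.hasSum_iUnion' C hC hd ξ
  have h2 : HasSum (fun i => Ω (C i) ξ) (∑ i ∈ Finset.range 2, Ω (C i) ξ) :=
    hasSum_sum_of_ne_finset_zero fun n hn => by
      have : 2 ≤ n := not_lt.mp fun h => hn (Finset.mem_range.mpr h)
      have h0 : C n = ∅ := by
        simp only [C]; rw [if_neg (by omega), if_neg (by omega)]
      rw [h0, Ω.empty', zero_apply]
  rw [← hU, h1.unique h2]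
  simp [Finset.sum_range_succ, C]

lemma apply_biUnion {ι : Type*} (s : Finset ι) {B : ι → Set ℝ} (hB : ∀ i, MeasurableSet (B i))
    (hd : Pairwise (Function.onFun Disjoint B)) : Ω (⋃ i ∈ s, B i) = ∑ i ∈ s, Ω (B i) := by
  classical
  induction s using Finset.induction_on with
  | empty => simp [Ω.empty']
  | insert a s ha ih =>
    rw [Finset.set_biUnion_insert, apply_union Ω (hB a)
      (Finset.measurableSet_biUnion _ fun i _ => hB i), ih, Finset.sum_insert ha]
    rw [Set.disjoint_iUnion₂_right]
    exact fun i hi => hd (fun h => ha (h ▸ hi))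

lemma apply_map_preimage {γ δ : Type*} [DecidableEq δ] (h : SimpleFunc ℝ γ) (q : γ → δ) (d : δ) :
    Ω (h.map q ⁻¹' {d}) = ∑ c ∈ h.range with q c = d, Ω (h ⁻¹' {c}) := by
  rw [SimpleFunc.map_preimage_singleton, ← apply_biUnion Ω]
  · congr 1
    ext t
    simp
  · exact fun c => h.measurableSet_fiber c
  · intro c c' hc
    exact Set.disjoint_singleton.mpr hc |>.preimage _

/-- The integral `∫ ⟪u(h(t)), dΩ(t) v(h(t))⟫` of a pair of vector-valued functions which factor
through a simple function `h`. -/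
def sesq {γ : Type*} (h : SimpleFunc ℝ γ) (u v : γ → 𝒦) : ℂ :=
  ∑ c ∈ h.range, ⟪u c, Ω (h ⁻¹' {c}) (v c)⟫_ℂ

/-- Passing to a finer partition does not change the sum, by additivity of `Ω` over the fibres of
`q`. -/
lemma sesq_map {γ δ : Type*} (h : SimpleFunc ℝ γ) (q : γ → δ) (u v : δ → 𝒦) :
    Ω.sesq (h.map q) u v = Ω.sesq h (u ∘ q) (v ∘ q) := by
  classical
  unfold sesq
  rw [SimpleFunc.range_map, ← Finset.sum_fiberwise_of_maps_to
    (fun c hc => Finset.mem_image_of_mem q hc)]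
  refine Finset.sum_congr rfl fun d _ => ?_
  rw [apply_map_preimage, sum_apply, inner_sum]
  refine Finset.sum_congr rfl fun c hc => ?_
  simp only [Finset.mem_filter] at hc
  simp [hc.2]

lemma sesq_conj {γ : Type*} (h : SimpleFunc ℝ γ) (u v : γ → 𝒦) :
    starRingEnd ℂ (Ω.sesq h v u) = Ω.sesq h u v := by
  unfold sesq
  rw [map_sum]
  refine Finset.sum_congr rfl fun c _ => ?_
  rw [inner_conj_symm]
  exact (Ω.isPositive' _ (h.measurableSet_fiber c)).isSymmetric _ _

lemma sesq_mono {γ : Type*} (h : SimpleFunc ℝ γ) {u v : γ → 𝒦}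
    (huv : ∀ c ∈ h.range, (⟪u c, Ω (h ⁻¹' {c}) (u c)⟫_ℂ).re
      ≤ (⟪v c, Ω (h ⁻¹' {c}) (v c)⟫_ℂ).re) :
    (Ω.sesq h u u).re ≤ (Ω.sesq h v v).re := by
  unfold sesq
  rw [Complex.re_sum, Complex.re_sum]
  exact Finset.sum_le_sum huv

lemma re_inner_apply_nonneg {A : Set ℝ} (hA : MeasurableSet A) (x : 𝒦) :
    0 ≤ (⟪x, Ω A x⟫_ℂ).re := by
  exact (Ω.isPositive' A hA).re_inner_nonneg_right x

/-! ### The semi-inner product space of simple functions -/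

/-- The space of `𝒦`-valued simple functions, carrying the semi-inner product
`⟪f, g⟫ = ∫ ⟪f(t), dΩ(t) g(t)⟫`. -/
def Pre (_ : PositiveOperatorMeasure 𝒦) : Type u := SimpleFunc ℝ 𝒦

instance : AddCommGroup Ω.Pre := inferInstanceAs (AddCommGroup (SimpleFunc ℝ 𝒦))
instance : Module ℂ Ω.Pre := inferInstanceAs (Module ℂ (SimpleFunc ℝ 𝒦))

/-- A simple function as an element of the semi-inner product space. -/
def toPre : SimpleFunc ℝ 𝒦 ≃ₗ[ℂ] Ω.Pre := LinearEquiv.refl ℂ (SimpleFunc ℝ 𝒦)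

/-- The semi-inner product on simple functions. -/
def form (f g : SimpleFunc ℝ 𝒦) : ℂ := Ω.sesq (f.pair g) Prod.fst Prod.snd

/-- The form may be computed on any common refinement, which turns identities among several
functions into termwise ones. -/
lemma form_eq {γ : Type*} (h : SimpleFunc ℝ γ) (u v : γ → 𝒦) :
    Ω.form (h.map u) (h.map v) = Ω.sesq h u v :=
  Ω.sesq_map h (fun c => (u c, v c)) _ _

instance preCore : PreInnerProductSpace.Core ℂ Ω.Pre where
  inner f g := Ω.form f g
  conj_inner_symm f g := by
    have h1 : Ω.form f g = _ := Ω.form_eq (SimpleFunc.pair f g) Prod.fst Prod.snd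
    have h2 : Ω.form g f = _ := Ω.form_eq (SimpleFunc.pair f g) Prod.snd Prod.fst
    change starRingEnd ℂ (Ω.form g f) = Ω.form f g
    rw [h1, h2, sesq_conj]
  re_inner_nonneg f := by
    have h1 : Ω.form f f = _ := Ω.form_eq f id id
    change 0 ≤ (Ω.form f f).re
    rw [h1]
    simp only [sesq, Complex.re_sum]
    exact Finset.sum_nonneg fun c _ =>
      Ω.re_inner_apply_nonneg (SimpleFunc.measurableSet_fiber f c) _
  add_left f g k := by
    let h := SimpleFunc.pair f (SimpleFunc.pair g k)
    have h1 : Ω.form f k = _ := Ω.form_eq h (fun c => c.1) (fun c => c.2.2)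
    have h2 : Ω.form g k = _ := Ω.form_eq h (fun c => c.2.1) (fun c => c.2.2)
    have h3 : Ω.form (f + g) k = _ := Ω.form_eq h (fun c => c.1 + c.2.1) (fun c => c.2.2)
    change Ω.form (f + g) k = Ω.form f k + Ω.form g k
    rw [h1, h2, h3]
    simp [sesq, Finset.sum_add_distrib]
  smul_left f g c := by
    let h := SimpleFunc.pair f g
    have h1 : Ω.form f g = _ := Ω.form_eq h (fun c => c.1) (fun c => c.2)
    have h2 : Ω.form (c • f) g = _ := Ω.form_eq h (fun d => c • d.1) (fun c => c.2)
    change Ω.form (c • f) g = starRingEnd ℂ c * Ω.form f g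
    rw [h1, h2]
    simp [sesq, Finset.mul_sum, mul_comm]

instance : SeminormedAddCommGroup Ω.Pre :=
  @InnerProductSpace.Core.toSeminormedAddCommGroup ℂ Ω.Pre _ _ _ Ω.preCore
instance : InnerProductSpace ℂ Ω.Pre := InnerProductSpace.ofCore Ω.preCore

lemma inner_toPre {γ : Type*} (h : SimpleFunc ℝ γ) (u v : γ → 𝒦) :
    ⟪Ω.toPre (h.map u), Ω.toPre (h.map v)⟫_ℂ = Ω.sesq h u v := Ω.form_eq h u v

lemma norm_toPre_sq {γ : Type*} (h : SimpleFunc ℝ γ) (u : γ → 𝒦) :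
    ‖Ω.toPre (h.map u)‖ ^ 2 = (Ω.sesq h u u).re := by
  rw [← inner_toPre, ← RCLike.re_eq_complex_re, inner_self_eq_norm_sq]

/-- Multiplication of simple functions by a scalar simple function. -/
def preMul (s : SimpleFunc ℝ ℂ) : Ω.Pre →ₗ[ℂ] Ω.Pre where
  toFun f := Ω.toPre ((s.pair (Ω.toPre.symm f)).map fun p => p.1 • p.2)
  map_add' f g := by
    apply Ω.toPre.symm.injective
    ext t
    exact smul_add (s t) _ _
  map_smul' c f := by
    apply Ω.toPre.symm.injective
    ext t
    exact smul_comm (s t) c _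

lemma preMul_toPre {γ : Type*} (h : SimpleFunc ℝ γ) (a : γ → ℂ) (u : γ → 𝒦) :
    Ω.preMul (h.map a) (Ω.toPre (h.map u)) = Ω.toPre (h.map fun c => a c • u c) := rfl

/-- On each cell multiplication scales a nonnegative quadratic form by `|s|² ≤ C²`. -/
lemma norm_preMul_le {s : SimpleFunc ℝ ℂ} {C : ℝ} (hC : ∀ t, ‖s t‖ ≤ C) (f : Ω.Pre) :
    ‖Ω.preMul s f‖ ≤ C * ‖f‖ := by
  have hC0 : 0 ≤ C := (norm_nonneg _).trans (hC 0)
  let h := s.pair (Ω.toPre.symm f)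
  refine le_of_sq_le_sq ?_ (by positivity)
  have h1 : ‖f‖ ^ 2 = _ := Ω.norm_toPre_sq h Prod.snd
  have h2 : ‖Ω.preMul s f‖ ^ 2 = _ := Ω.norm_toPre_sq h fun c => c.1 • c.2
  have h3 : C ^ 2 * (Ω.sesq h Prod.snd Prod.snd).re
      = (Ω.sesq h (fun c => (C : ℂ) • c.2) (fun c => (C : ℂ) • c.2)).re := by
    simp only [sesq, Complex.re_sum, Finset.mul_sum, map_smul, inner_smul_left,
      inner_smul_right, Complex.conj_ofReal, Complex.re_ofReal_mul]
    exact Finset.sum_congr rfl fun c _ => by ring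
  rw [mul_pow, h1, h2, h3]
  refine Ω.sesq_mono h fun c hc => ?_
  obtain ⟨t, rfl⟩ := SimpleFunc.mem_range.mp hc
  have h4 := Ω.re_inner_apply_nonneg (h.measurableSet_fiber (h t)) (h t).2
  have h5 : ‖(h t).1‖ ^ 2 ≤ C ^ 2 := pow_le_pow_left₀ (norm_nonneg _) (hC t) 2
  simp only [map_smul, inner_smul_left, inner_smul_right, ← mul_assoc,
    Complex.mul_conj', Complex.conj_ofReal]
  norm_cast
  rw [Complex.re_ofReal_mul, Complex.re_ofReal_mul]
  refine mul_le_mul_of_nonneg_right ?_ h4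
  rw [← pow_two]
  exact_mod_cast h5

lemma exists_norm_le (s : SimpleFunc ℝ ℂ) : ∃ C, ∀ t, ‖s t‖ ≤ C :=
  (s.map norm).exists_forall_le

/-! ### The dilation space and its multiplication operators -/

/-- The Hilbert space of the dilation of `Ω`. -/
abbrev Space : Type u := UniformSpace.Completion Ω.Pre

/-- Multiplication by a scalar simple function on the space of the dilation. -/
def mul (s : SimpleFunc ℝ ℂ) : Ω.Space →L[ℂ] Ω.Space :=
  ((Ω.preMul s).mkContinuousOfExistsBound
    ((exists_norm_le s).imp fun _ hC => Ω.norm_preMul_le hC)).completion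

/-- A simple function as a vector of the Hilbert space. -/
def vec : SimpleFunc ℝ 𝒦 →ₗ[ℂ] Ω.Space :=
  (UniformSpace.Completion.toComplₗᵢ (𝕜 := ℂ) (E := Ω.Pre)).toLinearMap ∘ₗ Ω.toPre.toLinearMap

lemma vec_apply (f : SimpleFunc ℝ 𝒦) : Ω.vec f = ((Ω.toPre f : Ω.Pre) : Ω.Space) := rfl

lemma denseRange_vec : DenseRange Ω.vec :=
  UniformSpace.Completion.denseRange_coe (α := Ω.Pre)

lemma inner_vec {γ : Type*} (h : SimpleFunc ℝ γ) (u v : γ → 𝒦) :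
    ⟪Ω.vec (h.map u), Ω.vec (h.map v)⟫_ℂ = Ω.sesq h u v := by
  rw [vec_apply, vec_apply, UniformSpace.Completion.inner_coe, inner_toPre]

lemma mul_vec {γ : Type*} (h : SimpleFunc ℝ γ) (a : γ → ℂ) (u : γ → 𝒦) :
    Ω.mul (h.map a) (Ω.vec (h.map u)) = Ω.vec (h.map fun c => a c • u c) := by
  rw [vec_apply, vec_apply, mul, ContinuousLinearMap.completion_apply_coe,
    LinearMap.mkContinuousOfExistsBound_apply, preMul_toPre]

lemma mul_vec_eq (s : SimpleFunc ℝ ℂ) (f : SimpleFunc ℝ 𝒦) :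
    Ω.mul s (Ω.vec f) = Ω.vec ((s.pair f).map fun c => c.1 • c.2) :=
  Ω.mul_vec (s.pair f) Prod.fst Prod.snd

lemma norm_mul_le {s : SimpleFunc ℝ ℂ} {C : ℝ} (hC : ∀ t, ‖s t‖ ≤ C) : ‖Ω.mul s‖ ≤ C := by
  have hC0 : 0 ≤ C := (norm_nonneg _).trans (hC 0)
  refine opNorm_le_bound _ hC0 fun x => ?_
  induction x using UniformSpace.Completion.induction_on with
  | hp => exact isClosed_le (by fun_prop) (by fun_prop)
  | ih f =>
    rw [mul, ContinuousLinearMap.completion_apply_coe, UniformSpace.Completion.norm_coe,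
      UniformSpace.Completion.norm_coe]
    exact Ω.norm_preMul_le hC f

lemma ext_vec {S T : Ω.Space →L[ℂ] Ω.Space} (h : ∀ f, S (Ω.vec f) = T (Ω.vec f)) : S = T :=
  ContinuousLinearMap.coeFn_injective
    (Ω.denseRange_vec.equalizer S.continuous T.continuous (funext h))

lemma mul_mul (s t : SimpleFunc ℝ ℂ) : Ω.mul (s * t) = Ω.mul s * Ω.mul t := by
  refine Ω.ext_vec fun f => ?_
  rw [mul_apply_eq_comp, mul_vec_eq, mul_vec_eq, mul_vec_eq]
  congr 1
  ext x
  exact mul_smul _ _ _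

lemma mul_add (s t : SimpleFunc ℝ ℂ) : Ω.mul (s + t) = Ω.mul s + Ω.mul t := by
  refine Ω.ext_vec fun f => ?_
  rw [add_apply, mul_vec_eq, mul_vec_eq, mul_vec_eq, ← map_add]
  congr 1
  ext x
  exact add_smul _ _ _

lemma mul_smul (c : ℂ) (s : SimpleFunc ℝ ℂ) : Ω.mul (c • s) = c • Ω.mul s := by
  refine Ω.ext_vec fun f => ?_
  rw [smul_apply, mul_vec_eq, mul_vec_eq, ← map_smul]
  congr 1
  ext x
  exact smul_assoc c (s x) (f x)

lemma mul_sub (s t : SimpleFunc ℝ ℂ) : Ω.mul (s - t) = Ω.mul s - Ω.mul t := by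
  rw [eq_sub_iff_add_eq, ← mul_add, sub_add_cancel]

lemma mul_one : Ω.mul 1 = 1 := by
  refine Ω.ext_vec fun f => ?_
  rw [mul_vec_eq, one_apply_eq_self]
  congr 1
  ext x
  exact one_smul ℂ (f x)

lemma simpleIntegral_one : Ω.simpleIntegral 1 = Ω Set.univ := by
  have : (1 : ℝ → ℂ) ⁻¹' {1} = Set.univ := by ext; simp
  simp [simpleIntegral, SimpleFunc.range_one, this]

lemma adjoint_mul (s : SimpleFunc ℝ ℂ) :
    adjoint (Ω.mul s) = Ω.mul (s.map (starRingEnd ℂ)) := by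
  refine (eq_adjoint_iff _ _).mpr ?_ |>.symm
  intro x y
  induction x, y using UniformSpace.Completion.induction_on₂ with
  | hp => exact isClosed_eq (by fun_prop) (by fun_prop)
  | ih f g =>
    -- On the joint partition of `s`, `f` and `g` both inner products are sums over the same cells.
    let h := s.pair (SimpleFunc.pair (Ω.toPre.symm f) (Ω.toPre.symm g))
    have h1 : Ω.mul (s.map (starRingEnd ℂ)) f = Ω.vec (h.map fun c => starRingEnd ℂ c.1 • c.2.1) :=
      Ω.mul_vec h (fun c => starRingEnd ℂ c.1) (fun c => c.2.1)
    have h2 : Ω.mul s g = Ω.vec (h.map fun c => c.1 • c.2.2) :=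
      Ω.mul_vec h (fun c => c.1) (fun c => c.2.2)
    rw [h1, h2]
    have h3 := Ω.inner_vec h (fun c => starRingEnd ℂ c.1 • c.2.1) (fun c => c.2.2)
    have h4 := Ω.inner_vec h (fun c => c.2.1) (fun c => c.1 • c.2.2)
    refine h3.trans (Eq.trans ?_ h4.symm)
    simp [sesq, mul_comm]

lemma norm_vec_const_sq (x : 𝒦) :
    ‖Ω.vec (SimpleFunc.const ℝ x)‖ ^ 2 = (⟪x, Ω Set.univ x⟫_ℂ).re := by
  have h := Ω.norm_toPre_sq (SimpleFunc.const ℝ ()) (fun _ => x)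
  rw [vec_apply, UniformSpace.Completion.norm_coe]
  refine h.trans ?_
  have : (SimpleFunc.const ℝ ()) ⁻¹' {()} = Set.univ := by ext; simp
  simp only [sesq, SimpleFunc.range_const, Finset.sum_singleton, this]

/-- The embedding of `𝒦` as constant functions. -/
def embed : 𝒦 →L[ℂ] Ω.Space :=
  (Ω.vec ∘ₗ { toFun := SimpleFunc.const ℝ
              map_add' := fun _ _ => rfl
              map_smul' := fun _ _ => rfl }).mkContinuousOfExistsBound (by
    -- The constant comes from `‖K x‖² = ⟪x, Ω(ℝ) x⟫ ≤ ‖Ω(ℝ)‖ ‖x‖²`.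
    refine ⟨√‖Ω Set.univ‖, fun x => ?_⟩
    refine le_of_sq_le_sq ?_ (by positivity)
    rw [mul_pow, Real.sq_sqrt (norm_nonneg _)]
    calc ‖Ω.vec (SimpleFunc.const ℝ x)‖ ^ 2
        = (⟪x, Ω Set.univ x⟫_ℂ).re := by rw [norm_vec_const_sq]
      _ ≤ ‖⟪x, Ω Set.univ x⟫_ℂ‖ := Complex.re_le_norm _
      _ ≤ ‖x‖ * (‖Ω Set.univ‖ * ‖x‖) := (norm_inner_le_norm _ _).trans (by
          gcongr; exact le_opNorm _ _)
      _ = _ := by ring)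

lemma embed_apply (x : 𝒦) : Ω.embed x = Ω.vec (SimpleFunc.const ℝ x) := rfl

lemma exists_tendsto_mul {s : ℕ → SimpleFunc ℝ ℂ} {f : ℝ → ℂ}
    (hs : TendstoUniformly (fun n t => s n t) f atTop) :
    ∃ T, Tendsto (fun n => Ω.mul (s n)) atTop (𝓝 T) := by
  refine cauchySeq_tendsto_of_complete (Metric.cauchySeq_iff'.mpr fun ε hε => ?_)
  obtain ⟨N, hN⟩ := eventually_atTop.mp (Metric.tendstoUniformly_iff.mp hs (ε / 4) (by positivity))
  refine ⟨N, fun n hn => ?_⟩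
  rw [dist_eq_norm, ← mul_sub]
  -- Two approximants within `ε / 4` of `f` differ by at most `ε / 2`, which leaves room for the
  -- strict inequality.
  refine (Ω.norm_mul_le (C := ε / 2) fun t => ?_).trans_lt (by linarith)
  rw [SimpleFunc.coe_sub, Pi.sub_apply, ← dist_eq_norm]
  have h1 := dist_triangle_left (s n t) (s N t) (f t)
  linarith [hN n hn t, hN N le_rfl t]

lemma tendsto_mul_zero {s : ℕ → SimpleFunc ℝ ℂ}
    (hs : TendstoUniformly (fun n t => s n t) (fun _ => 0) atTop) :
    Tendsto (fun n => Ω.mul (s n)) atTop (𝓝 0) := by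
  rw [Metric.tendsto_atTop]
  intro ε hε
  obtain ⟨N, hN⟩ := eventually_atTop.mp (Metric.tendstoUniformly_iff.mp hs (ε / 2) (by positivity))
  refine ⟨N, fun n hn => ?_⟩
  rw [dist_zero_right]
  refine (Ω.norm_mul_le (C := ε / 2) fun t => ?_).trans_lt (by linarith)
  have := hN n hn t
  rw [dist_zero_left] at this
  exact this.le

/-! ### Spectral projections, separability and injectivity -/

/-- The spectral projection of a Borel set on the space of the dilation. -/
def proj (A : Set ℝ) : Ω.Space →L[ℂ] Ω.Space := Ω.mul ((1 : SimpleFunc ℝ ℂ).restrict A)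

lemma proj_mul_proj {A B : Set ℝ} (hA : MeasurableSet A) (hB : MeasurableSet B) :
    Ω.proj A * Ω.proj B = Ω.proj (A ∩ B) := by
  rw [proj, proj, proj, ← mul_mul]
  congr 1
  ext t
  classical
  simp only [SimpleFunc.coe_mul, Pi.mul_apply, SimpleFunc.restrict_apply _ hA,
    SimpleFunc.restrict_apply _ hB, SimpleFunc.restrict_apply _ (hA.inter hB),
    Set.indicator_apply, Set.mem_inter_iff, SimpleFunc.coe_one, Pi.one_apply]
  split_ifs <;> simp_all

lemma proj_union {A B : Set ℝ} (hA : MeasurableSet A) (hB : MeasurableSet B)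
    (hd : Disjoint A B) : Ω.proj (A ∪ B) = Ω.proj A + Ω.proj B := by
  rw [proj, proj, proj, ← mul_add]
  congr 1
  ext t
  simp only [SimpleFunc.coe_add, Pi.add_apply, SimpleFunc.restrict_apply _ hA,
    SimpleFunc.restrict_apply _ hB, SimpleFunc.restrict_apply _ (hA.union hB)]
  rw [Set.indicator_union_of_disjoint hd]

lemma proj_univ : Ω.proj Set.univ = 1 := by
  rw [proj, SimpleFunc.restrict_univ, mul_one]

lemma proj_empty : Ω.proj ∅ = 0 := by
  have h := Ω.proj_union MeasurableSet.univ MeasurableSet.empty (Set.disjoint_empty _)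
  rw [Set.union_empty] at h
  simpa using h

lemma adjoint_proj (A : Set ℝ) : adjoint (Ω.proj A) = Ω.proj A := by
  rw [proj, adjoint_mul, SimpleFunc.map_restrict_of_zero (map_zero _)]
  congr 2
  ext t
  simp

lemma vec_piecewise {A : Set ℝ} (hA : MeasurableSet A) (x : 𝒦) :
    Ω.vec (SimpleFunc.piecewise A hA (SimpleFunc.const ℝ x) (SimpleFunc.const ℝ 0))
      = Ω.proj A (Ω.embed x) := by
  rw [proj, embed_apply, mul_vec_eq]
  congr 1
  ext t
  classical
  simp only [SimpleFunc.map_apply, SimpleFunc.pair_apply, SimpleFunc.restrict_apply _ hA,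
    SimpleFunc.piecewise_apply, Set.indicator_apply, SimpleFunc.const_apply, SimpleFunc.coe_one,
    Pi.one_apply]
  split_ifs <;> simp

/-- Simple functions are dense and are finite sums of indicators times constant vectors, so these
vectors generate the space. -/
lemma span_proj_embed_dense {W : Submodule ℂ Ω.Space} (hW : IsClosed (W : Set Ω.Space))
    (h : ∀ A, MeasurableSet A → ∀ x, Ω.proj A (Ω.embed x) ∈ W) : W = ⊤ := by
  rw [Submodule.eq_top_iff']
  intro ξ
  refine Ω.denseRange_vec.induction_on ξ hW fun f => ?_
  induction f using SimpleFunc.induction with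
  | const x hA => rw [vec_piecewise]; exact h _ hA x
  | add _ hf hg => rw [map_add]; exact W.add_mem hf hg

lemma simpleIntegral_restrict_one {A : Set ℝ} (hA : MeasurableSet A) :
    Ω.simpleIntegral ((1 : SimpleFunc ℝ ℂ).restrict A) = Ω A := by
  classical
  set s := (1 : SimpleFunc ℝ ℂ).restrict A with hs
  have hst : ∀ t, s t = if t ∈ A then 1 else 0 := fun t => by
    rw [hs, SimpleFunc.restrict_apply _ hA, Set.indicator_apply]; rfl
  have hsub : s.range ⊆ {0, 1} := fun c hc => by
    obtain ⟨t, rfl⟩ := SimpleFunc.mem_range.mp hc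
    rw [hst]; split_ifs <;> simp
  unfold simpleIntegral
  -- One of the values `0`, `1` is missed when `A` is `ℝ` or empty; its fibre then contributes `Ω ∅
  -- = 0`.
  rw [Finset.sum_subset hsub fun c _ hc => ?_]
  · rw [Finset.sum_pair zero_ne_one, zero_smul, zero_add, one_smul]
    congr 1
    ext t
    simp [hst]
  · rw [(SimpleFunc.preimage_eq_empty_iff s c).mpr hc, Ω.empty', smul_zero]

variable [CompleteSpace 𝒦]

/-- This is the dilation identity: compressing multiplication to the constants recovers the operator
integral. -/
lemma adjoint_embed_mul_embed (s : SimpleFunc ℝ ℂ) :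
    adjoint Ω.embed ∘L Ω.mul s ∘L Ω.embed = Ω.simpleIntegral s := by
  ext x
  refine ext_inner_left ℂ fun y => ?_
  rw [comp_apply, adjoint_inner_right, comp_apply, embed_apply, embed_apply]
  have h1 : Ω.mul s (Ω.vec (SimpleFunc.const ℝ x)) = Ω.vec (s.map fun c => c • x) :=
    Ω.mul_vec s (fun c => c) (fun _ => x)
  rw [h1]
  refine (Ω.inner_vec s (fun _ => y) (fun c => c • x)).trans ?_
  simp [sesq, simpleIntegral, sum_apply, inner_sum, inner_smul_right]

lemma norm_proj_embed_sq {A : Set ℝ} (hA : MeasurableSet A) (x : 𝒦) :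
    ‖Ω.proj A (Ω.embed x)‖ ^ 2 = (⟪x, Ω A x⟫_ℂ).re := by
  have h := Ω.adjoint_embed_mul_embed ((1 : SimpleFunc ℝ ℂ).restrict A)
  rw [simpleIntegral_restrict_one Ω hA] at h
  rw [← h, comp_apply, adjoint_inner_right, comp_apply]
  change _ = (⟪Ω.embed x, Ω.proj A (Ω.embed x)⟫_ℂ).re
  have h2 : Ω.proj A (Ω.embed x) = Ω.proj A (Ω.proj A (Ω.embed x)) := by
    rw [← mul_apply_eq_comp, proj_mul_proj Ω hA hA, Set.inter_self]
  rw [h2, ← adjoint_inner_left, adjoint_proj, ← h2, ← inner_self_eq_norm_sq (𝕜 := ℂ)]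
  rfl

/-- Countable additivity of the spectral projections on the range of the embedding. -/
lemma tendsto_sum_proj_embed {B : ℕ → Set ℝ} (hB : ∀ i, MeasurableSet (B i))
    (hd : Pairwise (Function.onFun Disjoint B)) (x : 𝒦) :
    Tendsto (fun n => ∑ i ∈ Finset.range n, Ω.proj (B i) (Ω.embed x)) atTop
      (𝓝 (Ω.proj (⋃ i, B i) (Ω.embed x))) := by
  set U := ⋃ i, B i with hU
  have hUm : MeasurableSet U := MeasurableSet.iUnion hB
  let V : ℕ → Set ℝ := fun n => ⋃ i ∈ Finset.range n, B i
  have hVm : ∀ n, MeasurableSet (V n) := fun n => Finset.measurableSet_biUnion _ fun i _ => hB i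
  have hVU : ∀ n, V n ⊆ U := fun n => Set.iUnion₂_subset fun i _ => Set.subset_iUnion B i
  have hV : ∀ n, Ω.proj (V n) (Ω.embed x) = ∑ i ∈ Finset.range n, Ω.proj (B i) (Ω.embed x) := by
    intro n
    induction n with
    | zero => simp [V, proj_empty]
    | succ n ih =>
      have : V (n + 1) = V n ∪ B n := by
        simp only [V, Finset.range_add_one, Finset.set_biUnion_insert]
        exact Set.union_comm _ _
      rw [this, proj_union Ω (hVm n) (hB n), add_apply, ih, Finset.sum_range_succ]
      rw [Set.disjoint_iUnion₂_left]
      exact fun i hi => hd (Finset.mem_range.mp hi).ne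
  -- The difference is the projection of the remainder `U \ V n`, so its squared norm is a quadratic
  -- form of `Ω` and strong additivity of `Ω` applies.
  have h1 : ∀ n, ‖(∑ i ∈ Finset.range n, Ω.proj (B i) (Ω.embed x)) - Ω.proj U (Ω.embed x)‖ ^ 2
      = (⟪x, Ω U x - ∑ i ∈ Finset.range n, Ω (B i) x⟫_ℂ).re := by
    intro n
    have e1 := Ω.proj_union (hVm n) (hUm.diff (hVm n)) Set.disjoint_sdiff_right
    have e2 := Ω.apply_union (hVm n) (hUm.diff (hVm n)) Set.disjoint_sdiff_right
    rw [Set.union_sdiff_cancel (hVU n)] at e1 e2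
    have e3 := Ω.apply_biUnion (Finset.range n) hB hd
    change Ω (V n) = _ at e3
    rw [← hV, e1, add_apply, norm_sub_rev, add_sub_cancel_left, norm_proj_embed_sq Ω
      (hUm.diff (hVm n)), e2, e3, add_apply, sum_apply, add_sub_cancel_left]
  have h2 : Tendsto (fun n => (⟪x, Ω U x - ∑ i ∈ Finset.range n, Ω (B i) x⟫_ℂ).re) atTop
      (𝓝 0) := by
    have h3 := (Ω.hasSum_iUnion' B hB hd x).tendsto_sum_nat
    have h4 : Tendsto (fun n => Ω U x - ∑ i ∈ Finset.range n, Ω (B i) x) atTop (𝓝 0) := by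
      simpa [← hU] using h3.const_sub (Ω U x)
    have h5 : Continuous fun y : 𝒦 => (⟪x, y⟫_ℂ).re := by fun_prop
    have h6 := (h5.tendsto 0).comp h4
    rwa [inner_zero_right, Complex.zero_re] at h6
  rw [tendsto_iff_norm_sub_tendsto_zero]
  have h3 := (h2.congr fun n => (h1 n).symm).sqrt
  simpa using h3

/-- The half-lines with rational endpoints form a π-system generating the Borel sets. Complements
and disjoint unions stay in the closed span `W`, so countably many separable images generate the
space. -/
instance [TopologicalSpace.SeparableSpace 𝒦] : TopologicalSpace.SeparableSpace Ω.Space := by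
  let S : Set Ω.Space := Set.range Ω.embed ∪
    ⋃ q : ℚ, Set.range fun x => Ω.proj (Set.Iic (q : ℝ)) (Ω.embed x)
  have hS : TopologicalSpace.IsSeparable S := by
    refine (TopologicalSpace.isSeparable_range Ω.embed.continuous).union
      (TopologicalSpace.IsSeparable.iUnion fun q => TopologicalSpace.isSeparable_range ?_)
    fun_prop
  let W := (Submodule.span ℂ S).topologicalClosure
  have hSW : S ⊆ W := Submodule.subset_span.trans (Submodule.le_topologicalClosure _)
  have hW : W = ⊤ := by
    refine Ω.span_proj_embed_dense (Submodule.isClosed_topologicalClosure _) fun A hA => ?_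
    induction A, hA using MeasurableSpace.induction_on_inter
      ((BorelSpace.measurable_eq).trans Real.borel_eq_generateFrom_Iic_rat)
      Real.isPiSystem_Iic_rat with
    | empty => simp [proj_empty]
    | basic A hA =>
      intro x
      obtain ⟨q, rfl⟩ : ∃ q : ℚ, A = Set.Iic (q : ℝ) := by
        simpa [eq_comm] using hA
      exact hSW (Or.inr (Set.mem_iUnion.mpr ⟨q, x, rfl⟩))
    | compl A hA ih =>
      intro x
      have h := Ω.proj_union hA hA.compl disjoint_compl_right
      rw [Set.union_compl_self, proj_univ] at h
      have h' : Ω.proj Aᶜ (Ω.embed x) = Ω.embed x - Ω.proj A (Ω.embed x) := by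
        have := congrArg (fun T => T (Ω.embed x)) h
        simp only [one_apply_eq_self, add_apply] at this
        rw [eq_sub_iff_add_eq', ← this]
      rw [h']
      exact W.sub_mem (hSW (Or.inl ⟨x, rfl⟩)) (ih x)
    | iUnion B hd hB ih =>
      intro x
      exact (Submodule.isClosed_topologicalClosure _).mem_of_tendsto
        (Ω.tendsto_sum_proj_embed hB hd x)
        (Eventually.of_forall fun n => W.sum_mem fun i _ => ih i x)
  have h := (hS.span (R := ℂ)).closure
  rw [← TopologicalSpace.isSeparable_univ_iff]
  have h' : closure (Submodule.span ℂ S : Set Ω.Space) = Set.univ := by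
    rw [← Submodule.topologicalClosure_coe]
    change (W : Set Ω.Space) = _
    rw [hW]; rfl
  rwa [h'] at h

/-- A vector annihilated by the projections of all bounded Borel sets vanishes. -/
lemma eq_zero_of_proj_eq_zero {ξ : Ω.Space}
    (h : ∀ A, MeasurableSet A → Bornology.IsBounded A → Ω.proj A ξ = 0) : ξ = 0 := by
  -- The level sets of `⌊|t|⌋₊` partition `ℝ` into bounded Borel sets.
  let B : ℕ → Set ℝ := fun n => {t | ⌊|t|⌋₊ = n}
  have hB : ∀ n, MeasurableSet (B n) := fun n =>
    (Nat.measurable_floor.comp measurable_norm) (measurableSet_singleton n)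
  have hBb : ∀ n, Bornology.IsBounded (B n) := fun n =>
    (Metric.isBounded_closedBall (x := (0 : ℝ)) (r := n + 1)).subset fun t ht => by
      rw [mem_closedBall_zero_iff, Real.norm_eq_abs]
      have := Nat.lt_floor_add_one |t|
      rw [show ⌊|t|⌋₊ = n from ht] at this
      exact this.le
  have hd : Pairwise (Function.onFun Disjoint B) := fun i j hij =>
    Set.disjoint_left.mpr fun t hi hj => hij (hi.symm.trans hj)
  have hU : ⋃ n, B n = Set.univ := Set.eq_univ_of_forall fun t => Set.mem_iUnion.mpr ⟨_, rfl⟩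
  have hinner : ∀ A, MeasurableSet A → ∀ x, ⟪ξ, Ω.proj A (Ω.embed x)⟫_ℂ = 0 := by
    intro A hA x
    have h1 := (Ω.tendsto_sum_proj_embed (fun i => hA.inter (hB i))
      (fun i j hij => (hd hij).mono Set.inter_subset_right Set.inter_subset_right) x)
    rw [← Set.inter_iUnion, hU, Set.inter_univ] at h1
    refine tendsto_nhds_unique ((tendsto_const_nhds (x := ξ)).inner (𝕜 := ℂ) h1) ?_
    refine tendsto_const_nhds.congr fun n => ?_
    rw [inner_sum, Finset.sum_eq_zero]
    intro i _
    rw [← adjoint_proj, adjoint_inner_right, h _ (hA.inter (hB i)) ((hBb i).subset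
      Set.inter_subset_right), inner_zero_left]
  have hW : (ℂ ∙ ξ)ᗮ = ⊤ := by
    refine Ω.span_proj_embed_dense (Submodule.isClosed_orthogonal _) fun A hA x => ?_
    rw [Submodule.mem_orthogonal_singleton_iff_inner_right]
    exact hinner A hA x
  have : ξ ∈ (ℂ ∙ ξ)ᗮ := hW ▸ Submodule.mem_top
  rwa [Submodule.mem_orthogonal_singleton_iff_inner_right, inner_self_eq_zero] at this

/-- This gives injectivity of the future resolvent at `i`: on a bounded set the multiplier can be
inverted boundedly. -/
lemma eq_zero_of_tendsto_mul_eq_zero {s : ℕ → SimpleFunc ℝ ℂ}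
    (hs : TendstoUniformly (fun n t => s n t) (fun t : ℝ => ((t : ℂ) - Complex.I)⁻¹) atTop)
    {ξ : Ω.Space} (h : Tendsto (fun n => Ω.mul (s n) ξ) atTop (𝓝 0)) : ξ = 0 := by
  refine Ω.eq_zero_of_proj_eq_zero fun A hA hAb => ?_
  obtain ⟨r, hr⟩ := hAb.subset_closedBall 0
  -- On `A` the limit has modulus at least `2 / C`, so an approximant within `1 / C` has modulus at
  -- least `1 / C` and a reciprocal bounded by `C`.
  set C := 2 * (|r| + 1) with hC
  have hC0 : 0 < C := by positivity
  have hlow : ∀ t ∈ A, 2 / C ≤ ‖((t : ℂ) - Complex.I)⁻¹‖ := fun t ht => by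
    have h1 : ‖(t : ℂ) - Complex.I‖ ≤ |r| + 1 := by
      refine (norm_sub_le _ _).trans ?_
      rw [Complex.norm_I, Complex.norm_real]
      have := mem_closedBall_zero_iff.mp (hr ht)
      linarith [le_abs_self r]
    have h0 : 0 < ‖(t : ℂ) - Complex.I‖ := by
      rw [norm_pos_iff]
      intro h
      simpa using congrArg Complex.im h
    rw [norm_inv, hC, div_le_iff₀ (by positivity), inv_mul_eq_div, le_div_iff₀ h0]
    linarith
  have key : ∀ᶠ n in atTop, ‖Ω.proj A ξ‖ ≤ C * ‖Ω.mul (s n) ξ‖ := by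
    filter_upwards [Metric.tendstoUniformly_iff.mp hs (1 / C) (by positivity)] with n hn
    have hsn : ∀ t ∈ A, 1 / C ≤ ‖s n t‖ := fun t ht => by
      have h1 := hlow t ht
      have h2 := hn t
      rw [dist_eq_norm] at h2
      have h3 := norm_le_norm_add_norm_sub' ((t : ℂ) - Complex.I)⁻¹ (s n t)
      have h4 : 2 / C = 1 / C + 1 / C := by ring
      linarith
    -- With `0⁻¹ = 0`, this is the reciprocal of `s n` on `A` and zero elsewhere.
    let q := ((s n).restrict A).map (·⁻¹)
    have hq : ∀ t, q t = A.indicator (fun t => (s n t)⁻¹) t := fun t => by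
      classical
      simp only [q, SimpleFunc.map_apply, SimpleFunc.restrict_apply _ hA, Set.indicator_apply]
      split_ifs <;> simp
    have hqs : q * s n = (1 : SimpleFunc ℝ ℂ).restrict A := by
      ext t
      classical
      rw [SimpleFunc.coe_mul, Pi.mul_apply, hq, SimpleFunc.restrict_apply _ hA,
        Set.indicator_apply, Set.indicator_apply]
      split_ifs with ht
      · refine inv_mul_cancel₀ (norm_pos_iff.mp ((hsn t ht).trans_lt' (by positivity)))
      · simp
    have hqb : ∀ t, ‖q t‖ ≤ C := fun t => by
      classical
      rw [hq, Set.indicator_apply]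
      split_ifs with ht
      · rw [norm_inv]
        refine inv_le_of_inv_le₀ hC0 ?_
        rw [← one_div]; exact hsn t ht
      · simpa using hC0.le
    rw [proj, ← hqs, mul_mul, mul_apply_eq_comp]
    exact (le_opNorm _ _).trans (mul_le_mul_of_nonneg_right (Ω.norm_mul_le hqb) (norm_nonneg _))
  have hlim : Tendsto (fun n => C * ‖Ω.mul (s n) ξ‖) atTop (𝓝 0) := by
    simpa using h.norm.const_mul C
  exact norm_le_zero_iff.mp (ge_of_tendsto hlim key)

end PositiveOperatorMeasure

end Dilation

/-! ### Realizations of Stieltjes transforms and the linear fractional relation -/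

section Realization

open ContinuousLinearMap Filter MeasureTheory
open scoped InnerProductSpace

variable {𝒦 : Type u} [NormedAddCommGroup 𝒦] [InnerProductSpace ℂ 𝒦] [CompleteSpace 𝒦]

lemma norm_inv_ofReal_sub_le {z : ℂ} (h : z.im ≠ 0) (t : ℝ) :
    ‖((t : ℂ) - z)⁻¹‖ ≤ |z.im|⁻¹ := by
  rw [norm_inv]
  refine inv_anti₀ (abs_pos.mpr h) ?_
  simpa using Complex.abs_im_le_norm ((t : ℂ) - z)

/-- The dilation of `Ω` carries a self-adjoint operator realizing the Stieltjes transform. -/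
theorem PositiveOperatorMeasure.exists_isRealizedBy_embed (Ω : PositiveOperatorMeasure 𝒦)
    {M : ℂ → (𝒦 →L[ℂ] 𝒦)} (hM : IsStieltjesRepresentation M Ω) :
    ∃ H : Ω.Space →ₗ.[ℂ] Ω.Space, IsSelfAdjoint H ∧ IsRealizedBy M H Ω.embed := by
  have hex : ∀ z : ℂ, ∃ (s : ℕ → SimpleFunc ℝ ℂ) (R : Ω.Space →L[ℂ] Ω.Space), z.im ≠ 0 →
      TendstoUniformly (fun n t => s n t) (fun t : ℝ => ((t : ℂ) - z)⁻¹) atTop ∧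
      Tendsto (fun n => Ω.simpleIntegral (s n)) atTop (𝓝 (M z)) ∧
      Tendsto (fun n => Ω.mul (s n)) atTop (𝓝 R) := fun z => by
    by_cases hz : z.im = 0
    -- Junk values at real `z` make the chosen families total.
    · exact ⟨0, 0, fun h => (h hz).elim⟩
    · obtain ⟨s, hs, hs'⟩ := hM z hz
      obtain ⟨R, hR⟩ := Ω.exists_tendsto_mul hs
      exact ⟨s, R, fun _ => ⟨hs, hs', hR⟩⟩
  choose s R hsR using hex
  have hne : ∀ z : ℂ, z.im ≠ 0 → ∀ t : ℝ, (t : ℂ) - z ≠ 0 := fun z hz t h => by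
    apply hz
    simpa using congrArg Complex.im h
  have hadj : ∀ z : ℂ, z.im ≠ 0 → adjoint (R z) = R (starRingEnd ℂ z) := fun z hz => by
    have hz' : (starRingEnd ℂ z).im ≠ 0 := by simpa using hz
    obtain ⟨h1, -, h2⟩ := hsR z hz
    obtain ⟨h3, -, h4⟩ := hsR _ hz'
    have h5 := h1.continuous_comp_of_bounded h3 (C := |z.im|⁻¹) (norm_inv_ofReal_sub_le hz)
      (fun t => by simpa using norm_inv_ofReal_sub_le hz' t)
      (Φ := fun p => starRingEnd ℂ p.1 - p.2) (by fun_prop) (k := fun _ => 0)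
      (fun t => by simp)
    have h6 := Ω.tendsto_mul_zero
      (s := fun n => (s z n).map (starRingEnd ℂ) - s (starRingEnd ℂ z) n) h5
    have h7 : Tendsto (fun n => Ω.mul ((s z n).map (starRingEnd ℂ) - s (starRingEnd ℂ z) n)) atTop
        (𝓝 (adjoint (R z) - R (starRingEnd ℂ z))) := by
      simp only [Ω.mul_sub, ← Ω.adjoint_mul]
      exact ((adjoint.continuous.tendsto _).comp h2).sub h4
    exact sub_eq_zero.mp (tendsto_nhds_unique h7 h6)
  have hres : ∀ z w : ℂ, z.im ≠ 0 → w.im ≠ 0 → R z - R w = (z - w) • (R z * R w) := by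
    intro z w hz hw
    obtain ⟨h1, -, h2⟩ := hsR z hz
    obtain ⟨h3, -, h4⟩ := hsR w hw
    have h5 := h1.continuous_comp_of_bounded h3 (C := max |z.im|⁻¹ |w.im|⁻¹)
      (fun t => (norm_inv_ofReal_sub_le hz t).trans (le_max_left _ _))
      (fun t => (norm_inv_ofReal_sub_le hw t).trans (le_max_right _ _))
      -- This expression vanishes at `((t - z)⁻¹, (t - w)⁻¹)`, so the same expression in the
      -- multiplication operators tends to zero.
      (Φ := fun p => p.1 - p.2 - (z - w) • (p.1 * p.2)) (by fun_prop) (k := fun _ => 0)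
      (fun t => by
        have := hne z hz t
        have := hne w hw t
        simp only [smul_eq_mul]
        field_simp
        ring)
    have h6 := Ω.tendsto_mul_zero
      (s := fun n => s z n - s w n - (z - w) • (s z n * s w n)) h5
    have h7 : Tendsto (fun n => Ω.mul (s z n - s w n - (z - w) • (s z n * s w n))) atTop
        (𝓝 (R z - R w - (z - w) • (R z * R w))) := by
      simp only [Ω.mul_sub, Ω.mul_smul, Ω.mul_mul]
      exact (h2.sub h4).sub ((h2.mul h4).const_smul _)
    exact sub_eq_zero.mp (tendsto_nhds_unique h7 h6)
  have hinj : ∀ x, R Complex.I x = 0 → x = 0 := fun x hx => by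
    obtain ⟨h1, -, h2⟩ := hsR Complex.I (by simp)
    refine Ω.eq_zero_of_tendsto_mul_eq_zero h1 ?_
    rw [← hx]
    exact ((ContinuousLinearMap.apply ℂ Ω.Space x).continuous.tendsto _).comp h2
  obtain ⟨H, hH, hHR⟩ := exists_isSelfAdjoint_of_resolvent_identity hadj hres hinj
  refine ⟨H, hH, fun z hz => ⟨R z, hHR z hz, ?_⟩⟩
  obtain ⟨-, h1, h2⟩ := hsR z hz
  refine tendsto_nhds_unique h1 ?_
  simp only [← Ω.adjoint_embed_mul_embed]
  have hc : Continuous fun T : Ω.Space →L[ℂ] Ω.Space => adjoint Ω.embed ∘L T ∘L Ω.embed :=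
    continuous_const.clm_comp (continuous_id.clm_comp continuous_const)
  exact (hc.tendsto _).comp h2

lemma PositiveOperatorMeasure.adjoint_embed_comp_embed (Ω : PositiveOperatorMeasure 𝒦) :
    adjoint Ω.embed ∘L Ω.embed = Ω Set.univ := by
  have h := Ω.adjoint_embed_mul_embed 1
  rwa [Ω.mul_one, Ω.simpleIntegral_one] at h

/-- A realization determines `K^* K` as the strong limit of `-i y M(i y)`. -/
theorem IsRealizedBy.tendsto {ℋ : Type u} [NormedAddCommGroup ℋ] [InnerProductSpace ℂ ℋ]
    [CompleteSpace ℋ] {M : ℂ → (𝒦 →L[ℂ] 𝒦)} {A : ℋ →ₗ.[ℂ] ℋ} {K : 𝒦 →L[ℂ] ℋ}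
    (hA : IsSelfAdjoint A) (h : IsRealizedBy M A K) (x : 𝒦) :
    Tendsto (fun n : ℕ => (-((((n + 1 : ℕ) : ℝ) : ℂ) * Complex.I)) •
      M ((((n + 1 : ℕ) : ℝ) : ℂ) * Complex.I) x) atTop (𝓝 ((adjoint K ∘L K) x)) := by
  -- The shift `n + 1` keeps the point off the real axis at `n = 0`.
  have hz : ∀ n : ℕ, ((((n + 1 : ℕ) : ℝ) : ℂ) * Complex.I).im ≠ 0 := fun n => by
    simp
    positivity
  choose R hR hMR using fun n => h _ (hz n)
  have h1 := ((adjoint K).continuous.tendsto _).comp (tendsto_resolvent_imaginary hA hR (K x))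
  refine h1.congr fun n => ?_
  rw [hMR, Function.comp_apply, map_smul]
  rfl

/-- All self-adjoint realizations of a Stieltjes transform satisfy `K^* K = Ω(ℝ)`. -/
theorem IsRealizedBy.apply_univ_eq {ℋ : Type u} [NormedAddCommGroup ℋ] [InnerProductSpace ℂ ℋ]
    [CompleteSpace ℋ] {M : ℂ → (𝒦 →L[ℂ] 𝒦)} {A : ℋ →ₗ.[ℂ] ℋ} {K : 𝒦 →L[ℂ] ℋ}
    (hA : IsSelfAdjoint A) (h : IsRealizedBy M A K) {Ω : PositiveOperatorMeasure 𝒦}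
    (hM : IsStieltjesRepresentation M Ω) : Ω Set.univ = adjoint K ∘L K := by
  obtain ⟨H, hH, hHM⟩ := Ω.exists_isRealizedBy_embed hM
  ext x
  rw [← Ω.adjoint_embed_comp_embed]
  -- Both limits are of the same sequence, which involves `M` alone.
  exact tendsto_nhds_unique (hHM.tendsto hH x) (h.tendsto hA x)

/-- The transforms of a common realization are related by a linear fractional transformation. -/
theorem IsCommonRealization.linearFractionalRelation {ℋ : Type u} [NormedAddCommGroup ℋ]
    [InnerProductSpace ℂ ℋ] [CompleteSpace ℋ] {M₁ M₂ : ℂ → (𝒦 →L[ℂ] 𝒦)} {L₁ L₂ : 𝒦 →L[ℂ] 𝒦}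
    {H₀ : ℋ →ₗ.[ℂ] ℋ} {K : 𝒦 →L[ℂ] ℋ} (h : IsCommonRealization M₁ M₂ L₁ L₂ H₀ K) :
    LinearFractionalRelation M₁ M₂ L₁ L₂ := by
  intro z hz
  obtain ⟨R₁, hR₁, hM₁⟩ := h.realizes₁ z hz
  obtain ⟨R₂, hR₂, hM₂⟩ := h.realizes₂ z hz
  -- The resolvent identity in its two orders makes `1 - (L₂ - L₁) M₂(z)` a right and a left inverse
  -- of `1 + (L₂ - L₁) M₁(z)`.
  have e1 : M₂ z - M₁ z = M₁ z * (L₁ - L₂) * M₂ z := by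
    ext x
    have := congrArg (fun T => adjoint K (T (K x))) (hR₁.sub_eq_of_perturbation hR₂)
    simpa [hM₁, hM₂] using this
  have e2 : M₁ z - M₂ z = M₂ z * (L₂ - L₁) * M₁ z := by
    ext x
    have := congrArg (fun T => adjoint K (T (K x))) (hR₂.sub_eq_of_perturbation hR₁)
    simpa [hM₁, hM₂] using this
  generalize M₁ z = m at *
  generalize M₂ z = m' at *
  have h1 : (1 + (L₂ - L₁) * m) * (1 - (L₂ - L₁) * m') = 1 := by
    have : m - m' - m * (L₂ - L₁) * m' = 0 := by
      rw [← neg_sub m' m, e1]; noncomm_ring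
    calc _ = 1 + (L₂ - L₁) * (m - m' - m * (L₂ - L₁) * m') := by noncomm_ring
      _ = 1 := by rw [this, mul_zero, add_zero]
  have h2 : (1 - (L₂ - L₁) * m') * (1 + (L₂ - L₁) * m) = 1 := by
    calc _ = 1 + (L₂ - L₁) * (m - m' - m' * (L₂ - L₁) * m) := by noncomm_ring
      _ = 1 := by rw [e2, sub_self, mul_zero, add_zero]
  let U : (𝒦 →L[ℂ] 𝒦)ˣ := ⟨_, _, h1, h2⟩
  refine ⟨⟨U, rfl⟩, ?_⟩
  have h3 : Ring.inverse (1 + (L₂ - L₁) * m) = 1 - (L₂ - L₁) * m' := Ring.inverse_unit U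
  rw [h3]
  calc m' = m + (m' - m) := by abel
    _ = m * (1 - (L₂ - L₁) * m') := by rw [e1]; noncomm_ring

lemma isSelfAdjoint_comp_comp_adjoint {ℋ : Type u} [NormedAddCommGroup ℋ]
    [InnerProductSpace ℂ ℋ] [CompleteSpace ℋ] (K : 𝒦 →L[ℂ] ℋ) {L : 𝒦 →L[ℂ] 𝒦}
    (hL : IsSelfAdjoint L) : IsSelfAdjoint (K ∘L L ∘L adjoint K) := by
  rw [isSelfAdjoint_iff', adjoint_comp, adjoint_comp, adjoint_adjoint, isSelfAdjoint_iff'.mp hL]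
  rfl

/-- A realization of `M₁` yields a common realization when the linear fractional relation holds. -/
theorem IsRealizedBy.isCommonRealization {ℋ : Type u} [NormedAddCommGroup ℋ]
    [InnerProductSpace ℂ ℋ] [CompleteSpace ℋ] {M₁ M₂ : ℂ → (𝒦 →L[ℂ] 𝒦)} {L₁ L₂ : 𝒦 →L[ℂ] 𝒦}
    (hL₁ : IsSelfAdjoint L₁) (hL₂ : IsSelfAdjoint L₂) {H : ℋ →ₗ.[ℂ] ℋ} {K : 𝒦 →L[ℂ] ℋ}
    (hH : IsSelfAdjoint H) (h : IsRealizedBy M₁ H K) (hM : LinearFractionalRelation M₁ M₂ L₁ L₂) :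
    IsCommonRealization M₁ M₂ L₁ L₂ (perturbedOperator H K (-L₁)) K := by
  have e : ∀ L, perturbedOperator (perturbedOperator H K (-L₁)) K L
      = perturbedOperator H K (L - L₁) := fun L => by
    unfold perturbedOperator
    rw [vadd_vadd]
    congr 1
    ext x
    simp [sub_eq_add_neg]
  have e0 : perturbedOperator H K 0 = H := by
    unfold perturbedOperator
    have : (K ∘L (0 : 𝒦 →L[ℂ] 𝒦) ∘L adjoint K).toLinearMap = 0 := by ext; simp
    rw [this, zero_vadd]
  have hsa : ∀ L, IsSelfAdjoint L → IsSelfAdjoint (perturbedOperator H K L) := fun L hL =>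
    hH.vadd_linearPMap (isSelfAdjoint_comp_comp_adjoint K hL)
  refine ⟨hsa _ hL₁.neg, ?_, ?_, ?_, ?_⟩
  · rwa [e, sub_self, e0]
  · rw [e]; exact hsa _ (hL₂.sub hL₁)
  · rwa [e, sub_self, e0]
  · rw [e]
    intro z hz
    obtain ⟨R, hR, hMR⟩ := h z hz
    obtain ⟨hu, hM₂⟩ := hM z hz
    rw [hM₂]
    have h1 := Ring.mul_inverse_cancel _ hu
    have h2 := Ring.inverse_mul_cancel _ hu
    generalize Ring.inverse (1 + (L₂ - L₁) * M₁ z) = N at *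
    rw [hMR] at h1 h2 ⊢
    refine ⟨_, hR.perturbation K (L₂ - L₁) N h1 h2, ?_⟩
    -- Substituting this into `M₁(z) N` gives the compression by `K` of the perturbed resolvent `R -
    -- R K N (L₂ - L₁) K^* R`.
    have h3 : N = 1 - N * ((L₂ - L₁) * (adjoint K ∘L R ∘L K)) := by
      rw [eq_sub_iff_add_eq, ← h2]; noncomm_ring
    conv_lhs => rw [h3]
    ext x
    simp

end Realization

end

theorem theoremt2p6 {𝒦 : Type u} [NormedAddCommGroup 𝒦] [InnerProductSpace ℂ 𝒦]
    [CompleteSpace 𝒦] [TopologicalSpace.SeparableSpace 𝒦] :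
    -- part (i)
    (∀ M ∈ NevanlinnaOne 𝒦, ∀ Ω : PositiveOperatorMeasure 𝒦, IsStieltjesRepresentation M Ω →
      ∃ (ℋ : Type u) (_ : NormedAddCommGroup ℋ) (_ : InnerProductSpace ℂ ℋ)
        (_ : CompleteSpace ℋ) (_ : TopologicalSpace.SeparableSpace ℋ)
        (H : ℋ →ₗ.[ℂ] ℋ) (K : 𝒦 →L[ℂ] ℋ),
        IsSelfAdjoint H ∧ IsRealizedBy M H K ∧
        Ω Set.univ = (ContinuousLinearMap.adjoint K).comp K) ∧
    -- part (ii)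
    (∀ M₁ ∈ NevanlinnaOne 𝒦, ∀ M₂ ∈ NevanlinnaOne 𝒦, ∀ Ω₁ Ω₂ : PositiveOperatorMeasure 𝒦,
      IsStieltjesRepresentation M₁ Ω₁ → IsStieltjesRepresentation M₂ Ω₂ →
      (∃ z : ℂ, z.im ≠ 0 ∧ M₁ z ≠ M₂ z) →
      ∀ L₁ L₂ : 𝒦 →L[ℂ] 𝒦, IsSelfAdjoint L₁ → IsSelfAdjoint L₂ →
        -- a common realization with `L₁, L₂` exists iff the two conditions hold
        ((∃ (ℋ : Type u) (_ : NormedAddCommGroup ℋ) (_ : InnerProductSpace ℂ ℋ)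
            (_ : CompleteSpace ℋ) (_ : TopologicalSpace.SeparableSpace ℋ)
            (H₀ : ℋ →ₗ.[ℂ] ℋ) (K : 𝒦 →L[ℂ] ℋ),
            IsCommonRealization M₁ M₂ L₁ L₂ H₀ K) ↔
          ((∃ (ℋ : Type u) (_ : NormedAddCommGroup ℋ) (_ : InnerProductSpace ℂ ℋ)
              (_ : CompleteSpace ℋ) (_ : TopologicalSpace.SeparableSpace ℋ)
              (K : 𝒦 →L[ℂ] ℋ),
              Ω₁ Set.univ = (ContinuousLinearMap.adjoint K).comp K ∧
              (ContinuousLinearMap.adjoint K).comp K = Ω₂ Set.univ) ∧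
            LinearFractionalRelation M₁ M₂ L₁ L₂)) ∧
        -- and in every common realization they hold with the operator `K` of that realization
        (∀ (ℋ : Type u) [NormedAddCommGroup ℋ] [InnerProductSpace ℂ ℋ]
            [CompleteSpace ℋ] [TopologicalSpace.SeparableSpace ℋ]
            (H₀ : ℋ →ₗ.[ℂ] ℋ) (K : 𝒦 →L[ℂ] ℋ),
            IsCommonRealization M₁ M₂ L₁ L₂ H₀ K →
            (Ω₁ Set.univ = (ContinuousLinearMap.adjoint K).comp K ∧
              (ContinuousLinearMap.adjoint K).comp K = Ω₂ Set.univ) ∧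
            LinearFractionalRelation M₁ M₂ L₁ L₂)) := by

  refine ⟨fun M _ Ω hΩ => ?_, fun M₁ _ M₂ _ Ω₁ Ω₂ hΩ₁ hΩ₂ _ L₁ L₂ hL₁ hL₂ => ?_⟩
  · obtain ⟨H, hH, hM⟩ := Ω.exists_isRealizedBy_embed hΩ
    exact ⟨Ω.Space, inferInstance, inferInstance, inferInstance, inferInstance, H, Ω.embed, hH, hM,
      Ω.adjoint_embed_comp_embed.symm⟩
  · have hnec : ∀ (ℋ : Type u) [NormedAddCommGroup ℋ] [InnerProductSpace ℂ ℋ]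
        [CompleteSpace ℋ] (H₀ : ℋ →ₗ.[ℂ] ℋ) (K : 𝒦 →L[ℂ] ℋ),
        IsCommonRealization M₁ M₂ L₁ L₂ H₀ K →
        (Ω₁ Set.univ = (ContinuousLinearMap.adjoint K).comp K ∧
          (ContinuousLinearMap.adjoint K).comp K = Ω₂ Set.univ) ∧
        LinearFractionalRelation M₁ M₂ L₁ L₂ := fun ℋ _ _ _ H₀ K h =>
      ⟨⟨h.realizes₁.apply_univ_eq h.selfAdjoint₁ hΩ₁,
        (h.realizes₂.apply_univ_eq h.selfAdjoint₂ hΩ₂).symm⟩, h.linearFractionalRelation⟩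
    refine ⟨⟨?_, ?_⟩, fun ℋ _ _ _ _ H₀ K h => hnec ℋ H₀ K h⟩
    · rintro ⟨ℋ, i₁, i₂, i₃, i₄, H₀, K, h⟩
      exact ⟨⟨ℋ, i₁, i₂, i₃, i₄, K, (hnec ℋ H₀ K h).1⟩, (hnec ℋ H₀ K h).2⟩
    · rintro ⟨-, hrel⟩
      obtain ⟨H, hH, hM⟩ := Ω₁.exists_isRealizedBy_embed hΩ₁
      exact ⟨Ω₁.Space, inferInstance, inferInstance, inferInstance, inferInstance, _, Ω₁.embed,
        hM.isCommonRealization hL₁ hL₂ hH hrel⟩
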